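/- Let $\mathbb T=\mathbb R/2\pi\mathbb Z$. For a bounded measurable function $f:\mathbb T\to\mathbb C$ put $\widehat f(k)=\frac1{2\pi}\int_{\mathbb T}f(t)e^{-ikt}\,dt$ for $k\in\mathbb Z$, and $\|\widehat f\|_{l^1(\mathbb Z)}=\sum_{k\in\mathbb Z}|\widehat f(k)|\in[0,\infty]$. Let $A(\mathbb T)$ be the space of continuous $f:\mathbb T\to\mathbb C$ with $\|f\|_{A(\mathbb T)}:=\|\widehat f\|_{l^1(\mathbb Z)}<\infty$. Continuous mappings $\varphi:\mathbb T\to\mathbb T$ are identified with continuous functions $\varphi:\mathbb R\to\mathbb R$ such that $\varphi(t+2\pi)\equiv\varphi(t)\pmod{2\pi}$ for all $t\in\mathbb R$. (i) Let $g:\mathbb T\to\mathbb R$ be a measurable function such that $\widehat{e^{i\lambda g}}\in l^1(\mathbb Z)$ for all $\lambda\in\mathbb R$ and $\sup_{\lambda\in\mathbb R}\|\widehat{e^{i\lambda g}}\|_{l^1(\mathbb Z)}<\infty$. Then $g$ is constant almost everywhere. (ii) Let $\varphi:\mathbb T\to\mathbb T$ be a continuous mapping that is absolutely continuous, i.e.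 the corresponding function $\varphi:\mathbb R\to\mathbb R$ is absolutely continuous on each interval of length $2\pi$. Suppose that there are an unbounded sequence of integers $(n_k)$ and a constant $C<\infty$ such that $e^{in_k\varphi}\in A(\mathbb T)$ and $\|e^{in_k\varphi}\|_{A(\mathbb T)}\le C$ for all $k$. Then $\varphi$ is linear with integer slope: there is $\nu\in\mathbb Z$ such that $\varphi(t)=\nu t+\varphi(0)$ for all $t\in\mathbb R$. -/

import Mathlib

open scoped ENNReal NNReal Real

instance twoPiPos : Fact (0 < 2 * π) := ⟨Real.two_pi_pos⟩

/-- The circle `ℝ / 2πℤ`. -/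
abbrev Torus : Type := AddCircle (2 * π)

/-- The `ℓ¹(ℤ)`-norm `∑ |f̂(k)|` of the sequence of Fourier coefficients of `f : 𝕋 → ℂ`, as an
element of `[0, ∞]`. A continuous `f` lies in `A(𝕋)` iff this is finite, and then it is
`‖f‖_{A(𝕋)}`. -/
noncomputable def wienerNorm (f : Torus → ℂ) : ℝ≥0∞ :=
  ∑' k : ℤ, ‖fourierCoeff f k‖ₑ

/-- Continuous mappings of the circle into itself, represented by continuous functions
`φ : ℝ → ℝ` with `φ (t + 2π) = φ t (mod 2π)`. -/
structure IsCircleMapping (φ : ℝ → ℝ) : Prop where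
  continuous : Continuous φ
  add_two_pi : ∀ t : ℝ, ∃ m : ℤ, φ (t + 2 * π) = φ t + 2 * π * m

theorem IsCircleMapping.periodic_exp {φ : ℝ → ℝ} (hφ : IsCircleMapping φ) (n : ℤ) :
    Function.Periodic (fun t : ℝ => Complex.exp (Complex.I * n * φ t)) (2 * π) := by
  intro t
  obtain ⟨m, hm⟩ := hφ.add_two_pi t
  simp only [hm]
  rw [Complex.exp_eq_exp_iff_exists_int]
  refine ⟨n * m, ?_⟩
  push_cast
  ring

/-- The function `e^{inφ}` on the circle: its value at the class of `t : ℝ` is `e^{inφ(t)}`. -/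
noncomputable def IsCircleMapping.expPow {φ : ℝ → ℝ} (hφ : IsCircleMapping φ) (n : ℤ) :
    Torus → ℂ :=
  (hφ.periodic_exp n).lift

section

open MeasureTheory AddCircle Filter Topology ComplexConjugate

/-! Both statements rest on a measurable Beurling–Helson theorem, `exists_ae_eq_const_mul_fourier`:
a unimodular `u` with `‖u ^ n‖ ≤ C` in the Wiener norm for all `n ≥ 0` is a multiple of a character.
By Parseval each `u ^ n` has a Fourier coefficient at least `1 / (C + 1)`, so the correlations `∫ (u
(t + a) / u t) ^ n dt` do not tend to zero in mean over `a`. By Wiener's lemma on atoms, some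
translate by an `a` of infinite order makes `u (t + a) / u t` equal a constant `c` on a set of
positive measure. The normalized quotient `w` also has powers bounded in the Wiener norm, and the
Cesàro means of `w ^ n` converge to the indicator of `{w = 1}`. That indicator therefore has an
absolutely convergent Fourier series, is a.e. continuous, and must be constant on the connected
circle. Hence `u (t + a) = c * u t` a.e., which leaves a single frequency in `u`.

For (i), every `e^{iλg}` is a multiple of a character; its frequency is divisible by every positive
integer, because `λ` can be divided, so it is zero. Letting `λ → 0` removes the ambiguity modulo
`2π`.

For (ii), `e^{in(φ(t + s/n) - φ(t))}` has Wiener norm at most `C ^ 2` and tends a.e. to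
`e^{isφ'(t)}` along the unbounded sequence. Part (i) makes `φ'` constant a.e., and absolute
continuity integrates this. -/

/-! ### Fourier coefficients and the Wiener norm -/

lemma integrable_of_norm_le_one {f : Torus → ℂ} (hf : Measurable f) (hf1 : ∀ t, ‖f t‖ ≤ 1) :
    Integrable f haarAddCircle :=
  Integrable.of_bound hf.aestronglyMeasurable 1 (ae_of_all _ hf1)

lemma memLp_of_norm_le_one {f : Torus → ℂ} (hf : Measurable f) (hf1 : ∀ t, ‖f t‖ ≤ 1)
    (p : ℝ≥0∞) : MemLp f p haarAddCircle :=
  MemLp.of_bound hf.aestronglyMeasurable 1 (ae_of_all _ hf1)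

lemma fourierCoeff_comp_add_right (f : Torus → ℂ) (a : Torus) (k : ℤ) :
    fourierCoeff (fun t => f (t + a)) k = fourier k a * fourierCoeff f k := by
  unfold fourierCoeff
  rw [← integral_add_right_eq_self (fun t => fourier (-k) t • f t) a, ← integral_const_mul]
  refine integral_congr_ae (ae_of_all _ fun t => ?_)
  have h1 : fourier k a * fourier (-k) (t + a) = (fourier (-k) t : ℂ) := by
    have h2 : (fourier k a : ℂ) * fourier (-k) a = 1 := by
      rw [← fourier_add]; simp
    rw [show (fourier (-k) (t + a) : ℂ) = fourier (-k) t * fourier (-k) a by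
      simp [fourier_apply, smul_add, toCircle_add]]
    linear_combination (fourier (-k) t : ℂ) * h2
  simp only [smul_eq_mul]
  rw [← mul_assoc, h1]

lemma enorm_fourier (k : ℤ) (a : Torus) : ‖(fourier k a : ℂ)‖ₑ = 1 := by
  rw [← ofReal_norm, fourier_apply, Circle.norm_coe, ENNReal.ofReal_one]

lemma wienerNorm_comp_add_right (f : Torus → ℂ) (a : Torus) :
    wienerNorm (fun t => f (t + a)) = wienerNorm f := by
  unfold wienerNorm
  refine tsum_congr fun k => ?_
  rw [fourierCoeff_comp_add_right, enorm_mul, enorm_fourier, one_mul]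

lemma wienerNorm_conj (f : Torus → ℂ) :
    wienerNorm (fun t => conj (f t)) = wienerNorm f := by
  unfold wienerNorm
  rw [← (Equiv.neg ℤ).tsum_eq fun k => ‖fourierCoeff f k‖ₑ]
  refine tsum_congr fun k => ?_
  have : fourierCoeff (fun t => conj (f t)) k = conj (fourierCoeff f (-k)) := by
    unfold fourierCoeff
    rw [← integral_conj]
    refine integral_congr_ae (ae_of_all _ fun t => ?_)
    simp only [smul_eq_mul, map_mul, ← fourier_neg, neg_neg]
  rw [this, Equiv.neg_apply, ← ofReal_norm, ← ofReal_norm, RCLike.norm_conj]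

lemma wienerNorm_const_mul (c : ℂ) (f : Torus → ℂ) :
    wienerNorm (fun t => c * f t) = ‖c‖ₑ * wienerNorm f := by
  unfold wienerNorm
  rw [← ENNReal.tsum_mul_left]
  refine tsum_congr fun k => ?_
  rw [fourierCoeff.const_mul, enorm_mul]

lemma wienerNorm_congr_ae {f g : Torus → ℂ} (h : f =ᵐ[haarAddCircle] g) :
    wienerNorm f = wienerNorm g := by
  unfold wienerNorm
  rw [fourierCoeff_congr_ae h]

/-- Fatou's lemma for the `ℓ¹`-norm of the Fourier coefficients. -/
lemma wienerNorm_le_of_tendsto {F : ℕ → Torus → ℂ} {f : Torus → ℂ} {C : ℝ≥0∞}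
    (hF : ∀ n, Measurable (F n)) (hF1 : ∀ n t, ‖F n t‖ ≤ 1)
    (hlim : ∀ᵐ t ∂haarAddCircle, Tendsto (fun n => F n t) atTop (𝓝 (f t)))
    (hC : ∀ n, wienerNorm (F n) ≤ C) : wienerNorm f ≤ C := by
  have key : ∀ k : ℤ, Tendsto (fun n => fourierCoeff (F n) k) atTop (𝓝 (fourierCoeff f k)) := by
    intro k
    refine tendsto_integral_of_dominated_convergence (fun _ => 1) ?_ (integrable_const _) ?_ ?_
    · intro n
      exact ((map_continuous (fourier (-k))).measurable.smul (hF n)).aestronglyMeasurable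
    · intro n
      refine ae_of_all _ fun t => ?_
      rw [norm_smul, fourier_apply, Circle.norm_coe, one_mul]
      exact hF1 n t
    · filter_upwards [hlim] with t ht
      exact ht.const_smul _
  unfold wienerNorm
  rw [ENNReal.tsum_eq_iSup_sum]
  refine iSup_le fun s => ?_
  refine le_of_tendsto' (tendsto_finsetSum s fun k _ => (key k).enorm) fun n => ?_
  exact (ENNReal.sum_le_tsum s).trans (hC n)

lemma summable_norm_fourierCoeff {f : Torus → ℂ} (hW : wienerNorm f ≠ ⊤) :
    Summable fun k => ‖fourierCoeff f k‖ := by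
  have := ENNReal.summable_toReal hW
  simpa using this

/-- The Fourier series converges uniformly to a continuous function, and in `L²` to `f`; the two
limits agree a.e. -/
lemma exists_continuous_ae_eq {f : Torus → ℂ} (hf : Measurable f) (hf1 : ∀ t, ‖f t‖ ≤ 1)
    (hW : wienerNorm f ≠ ⊤) :
    ∃ F : C(Torus, ℂ), f =ᵐ[haarAddCircle] F ∧
      ∀ t, HasSum (fun k => fourierCoeff f k * fourier k t) (F t) := by
  have hs : Summable fun k => fourierCoeff f k • (fourier k : C(Torus, ℂ)) := by
    refine .of_norm ?_
    simp_rw [norm_smul, fourier_norm, mul_one]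
    exact summable_norm_fourierCoeff hW
  obtain ⟨F, hF⟩ := hs
  refine ⟨F, ?_, fun t => ?_⟩
  · have hm := memLp_of_norm_le_one hf hf1 2
    have h1 := hasSum_fourier_series_L2 hm.toLp
    rw [fourierCoeff_congr_ae hm.coeFn_toLp] at h1
    have h2 := (ContinuousMap.toLp (E := ℂ) 2 haarAddCircle ℂ).hasSum hF
    simp only [map_smul] at h2
    have h3 := h1.unique h2
    exact hm.coeFn_toLp.symm.trans (h3 ▸ ContinuousMap.coeFn_toLp haarAddCircle F)
  · convert! (ContinuousMap.evalCLM ℂ t).hasSum hF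

/-- Only `f` needs an absolutely convergent series: it is expanded and integrated against the
bounded `g` term by term. -/
lemma fourierCoeff_mul_enorm_le {f g : Torus → ℂ} (hf : Measurable f) (hf1 : ∀ t, ‖f t‖ ≤ 1)
    (hg : Measurable g) (hg1 : ∀ t, ‖g t‖ ≤ 1) (hW : wienerNorm f ≠ ⊤) (k : ℤ) :
    ‖fourierCoeff (fun t => f t * g t) k‖ₑ ≤
      ∑' j, ‖fourierCoeff f j‖ₑ * ‖fourierCoeff g (k - j)‖ₑ := by
  obtain ⟨F, hfF, hF⟩ := exists_continuous_ae_eq hf hf1 hW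
  have hgi := integrable_of_norm_le_one hg hg1
  have hint : ∀ j : ℤ, Integrable
      (fun t => fourierCoeff f j * (fourier (-(k - j)) t • g t)) haarAddCircle := fun j =>
    (hgi.fourier_smul _).const_mul _
  have h1 := hasSum_integral_of_summable_integral_norm (μ := haarAddCircle)
    (F := fun j t => fourierCoeff f j * (fourier (-(k - j)) t • g t)) hint (by
      refine Summable.of_nonneg_of_le (fun j => integral_nonneg fun t => norm_nonneg _)
        (fun j => ?_) (summable_norm_fourierCoeff hW)
      have : ∫ t, ‖fourierCoeff f j * (fourier (-(k - j)) t • g t)‖ ∂haarAddCircle ≤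
          ∫ t : Torus, ‖fourierCoeff f j‖ ∂haarAddCircle := by
        refine integral_mono (hint j).norm (integrable_const _) fun t => ?_
        simp only
        rw [norm_mul, norm_smul, fourier_apply, Circle.norm_coe, one_mul]
        exact mul_le_of_le_one_right (norm_nonneg _) (hg1 t)
      simpa using this)
  have h2 : ∫ t, ∑' j, fourierCoeff f j * (fourier (-(k - j)) t • g t) ∂haarAddCircle =
      fourierCoeff (fun t => f t * g t) k := by
    refine integral_congr_ae ?_
    filter_upwards [hfF] with t ht
    have h3 := (hF t).mul_right (fourier (-k) t * g t)
    rw [← ht] at h3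
    rw [show fourier (-k) t • (f t * g t) = f t * (fourier (-k) t * g t) by
      rw [smul_eq_mul]; ring, ← h3.tsum_eq]
    refine tsum_congr fun j => ?_
    rw [show -(k - j) = j + -k by ring, fourier_add, smul_eq_mul]
    ring
  rw [h2] at h1
  rw [← h1.tsum_eq]
  refine (enorm_tsum_le_tsum_enorm).trans (le_of_eq (tsum_congr fun j => ?_))
  rw [integral_const_mul, enorm_mul]
  rfl

lemma wienerNorm_mul_le {f g : Torus → ℂ} (hf : Measurable f) (hf1 : ∀ t, ‖f t‖ ≤ 1)
    (hg : Measurable g) (hg1 : ∀ t, ‖g t‖ ≤ 1) (hW : wienerNorm f ≠ ⊤) :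
    wienerNorm (fun t => f t * g t) ≤ wienerNorm f * wienerNorm g := by
  calc wienerNorm (fun t => f t * g t)
      ≤ ∑' k : ℤ, ∑' j : ℤ, ‖fourierCoeff f j‖ₑ * ‖fourierCoeff g (k - j)‖ₑ :=
        ENNReal.tsum_le_tsum fun k => fourierCoeff_mul_enorm_le hf hf1 hg hg1 hW k
    _ = ∑' j : ℤ, ‖fourierCoeff f j‖ₑ * wienerNorm g := by
        rw [ENNReal.tsum_comm]
        refine tsum_congr fun j => ?_
        rw [ENNReal.tsum_mul_left]
        exact congrArg _ ((Equiv.subRight j).tsum_eq fun k => ‖fourierCoeff g k‖ₑ)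
    _ = wienerNorm f * wienerNorm g := ENNReal.tsum_mul_right

/-! ### Null sets on the circle -/

lemma ae_volume_iff_ae_haarAddCircle {p : Torus → Prop} :
    (∀ᵐ t, p t) ↔ ∀ᵐ t ∂haarAddCircle, p t := by
  rw [volume_eq_smul_haarAddCircle, Measure.ae_ennreal_smul_measure_iff]
  simp [Real.pi_pos]

lemma haarAddCircle_singleton (x : Torus) : haarAddCircle {x} = 0 := by
  have h : (volume : Measure Torus) {x} = 0 := by
    rw [← Metric.closedBall_zero, volume_closedBall]
    simp
  have h' : ∀ᵐ t : Torus, t ∉ ({x} : Set Torus) := measure_eq_zero_iff_ae_notMem.1 h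
  exact measure_eq_zero_iff_ae_notMem.2 (ae_volume_iff_ae_haarAddCircle.1 h')

/-- Almost every point of the circle has infinite order. -/
lemma ae_fourier_ne_one :
    ∀ᵐ a : Torus ∂haarAddCircle, ∀ k : ℤ, k ≠ 0 → (fourier k a : ℂ) ≠ 1 := by
  rw [ae_all_iff]
  intro k
  by_cases hk : k = 0
  · simp [hk]
  have hfin : {a : Torus | k.natAbs • a = 0}.Finite := finite_torsion _ (Int.natAbs_pos.2 hk)
  have hnull : haarAddCircle {a : Torus | k.natAbs • a = 0} = 0 := by
    have : NullSingletonClass (haarAddCircle (T := 2 * π)) := ⟨haarAddCircle_singleton⟩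
    exact hfin.measure_zero _
  filter_upwards [measure_eq_zero_iff_ae_notMem.1 hnull] with a ha _ h1
  apply ha
  have h2 : k • a = 0 := by
    rw [fourier_apply, Circle.coe_eq_one, ← toCircle_zero] at h1
    exact injective_toCircle Real.two_pi_pos.ne' h1
  rcases Int.natAbs_eq k with h | h <;> rw [h] at h2 <;> simpa using h2

/-! ### Cesàro means of powers and the zero-one law -/

lemma tendsto_cesaro_pow {z : ℂ} (hz : ‖z‖ = 1) :
    Tendsto (fun N : ℕ => ((N : ℂ) + 1)⁻¹ * ∑ n ∈ Finset.range (N + 1), z ^ n) atTop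
      (𝓝 (if z = 1 then 1 else 0)) := by
  split_ifs with h
  · refine tendsto_const_nhds.congr fun N => ?_
    have : (N : ℂ) + 1 ≠ 0 := by exact_mod_cast N.succ_ne_zero
    simp [h, this]
  · have h0 : 0 < ‖z - 1‖ := norm_pos_iff.2 (sub_ne_zero.2 h)
    have hlim : Tendsto (fun N : ℕ => 1 / ((N : ℝ) + 1) * (2 / ‖z - 1‖)) atTop (𝓝 0) := by
      simpa using tendsto_one_div_add_atTop_nhds_zero_nat.mul_const (2 / ‖z - 1‖)
    refine squeeze_zero_norm (fun N => ?_) hlim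
    rw [norm_mul, norm_inv, ← one_div]
    have h3 : ‖(N : ℂ) + 1‖ = (N : ℝ) + 1 := by
      rw [← Nat.cast_succ, Complex.norm_natCast, Nat.cast_succ]
    rw [h3]
    refine mul_le_mul_of_nonneg_left ?_ (by positivity)
    rw [geom_sum_eq h, norm_div]
    gcongr
    calc ‖z ^ (N + 1) - 1‖ ≤ ‖z ^ (N + 1)‖ + ‖(1 : ℂ)‖ := norm_sub_le _ _
      _ = 2 := by rw [norm_pow, hz]; norm_num

lemma norm_cesaro_pow_le {z : ℂ} (hz : ‖z‖ = 1) (N : ℕ) :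
    ‖((N : ℂ) + 1)⁻¹ * ∑ n ∈ Finset.range (N + 1), z ^ n‖ ≤ 1 := by
  have h3 : ‖(N : ℂ) + 1‖ = (N : ℝ) + 1 := by
    rw [← Nat.cast_succ, Complex.norm_natCast, Nat.cast_succ]
  rw [norm_mul, norm_inv, h3, inv_mul_le_iff₀ (by positivity)]
  refine (norm_sum_le _ _).trans ?_
  simp [hz]

lemma wienerNorm_cesaro_pow_le {w : Torus → ℂ} (hw : Measurable w) (hw1 : ∀ t, ‖w t‖ = 1)
    {C : ℝ≥0∞} (hC : ∀ n : ℕ, wienerNorm (fun t => w t ^ n) ≤ C) (N : ℕ) :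
    wienerNorm (fun t => ((N : ℂ) + 1)⁻¹ * ∑ n ∈ Finset.range (N + 1), w t ^ n) ≤ C := by
  rw [wienerNorm_const_mul]
  have hsum : wienerNorm (fun t => ∑ n ∈ Finset.range (N + 1), w t ^ n) ≤
      ∑ n ∈ Finset.range (N + 1), wienerNorm (fun t => w t ^ n) := by
    unfold wienerNorm
    rw [← Summable.tsum_finsetSum fun _ _ => ENNReal.summable]
    refine ENNReal.tsum_le_tsum fun k => ?_
    have h := fourierCoeff.sum (Finset.range (N + 1)) (fun n t => w t ^ n) fun n _ =>
      integrable_of_norm_le_one (hw.pow_const n) fun t => by rw [norm_pow, hw1, one_pow]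
    have h' : (fun t => ∑ n ∈ Finset.range (N + 1), w t ^ n) =
        ∑ n ∈ Finset.range (N + 1), fun t => w t ^ n := by
      ext t; simp
    rw [h', h, Finset.sum_apply]
    exact enorm_sum_le _ _
  calc ‖((N : ℂ) + 1)⁻¹‖ₑ * wienerNorm (fun t => ∑ n ∈ Finset.range (N + 1), w t ^ n)
      ≤ ‖((N : ℂ) + 1)⁻¹‖ₑ * ∑ n ∈ Finset.range (N + 1), C :=
        mul_le_mul_right (hsum.trans (Finset.sum_le_sum fun n _ => hC n)) _
    _ = ‖((N : ℂ) + 1)⁻¹‖ₑ * ‖(N : ℂ) + 1‖ₑ * C := by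
        have h3 : ‖(N : ℂ) + 1‖ₑ = (N : ℝ≥0∞) + 1 := by
          rw [← Nat.cast_succ, ← ofReal_norm, Complex.norm_natCast, ENNReal.ofReal_natCast,
            Nat.cast_succ]
        rw [h3]
        simp [mul_assoc]
    _ = C := by
        have h4 : (N : ℂ) + 1 ≠ 0 := by exact_mod_cast N.succ_ne_zero
        rw [← enorm_mul, inv_mul_cancel₀ h4, enorm_one, one_mul]

/-- A unimodular function whose powers are bounded in the Wiener norm takes the value `1`
either almost nowhere or almost everywhere. -/
lemma ae_eq_one_of_measure_ne_zero {w : Torus → ℂ} (hw : Measurable w) (hw1 : ∀ t, ‖w t‖ = 1)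
    {C : ℝ≥0∞} (hCt : C ≠ ⊤) (hC : ∀ n : ℕ, wienerNorm (fun t => w t ^ n) ≤ C)
    (h0 : haarAddCircle {t | w t = 1} ≠ 0) : ∀ᵐ t ∂haarAddCircle, w t = 1 := by
  have hS : MeasurableSet {t | w t = 1} := hw (measurableSet_singleton 1)
  set f : Torus → ℂ := fun t => if w t = 1 then 1 else 0 with hf
  have hfm : Measurable f := Measurable.ite hS measurable_const measurable_const
  have hf1 : ∀ t, ‖f t‖ ≤ 1 := fun t => by
    simp only [hf]; split_ifs <;> simp
  have hfW : wienerNorm f ≤ C := by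
    refine wienerNorm_le_of_tendsto
      (F := fun N t => ((N : ℂ) + 1)⁻¹ * ∑ n ∈ Finset.range (N + 1), w t ^ n) (fun N => ?_)
      (fun N t => norm_cesaro_pow_le (hw1 t) N)
      (ae_of_all _ fun t => tendsto_cesaro_pow (hw1 t)) (wienerNorm_cesaro_pow_le hw hw1 hC)
    fun_prop
  obtain ⟨F, hfF, -⟩ := exists_continuous_ae_eq hfm hf1 (ne_top_of_le_ne_top hCt hfW)
  -- An a.e. identity of continuous functions holds everywhere, so `F` takes only the values 0 and
  -- 1, and connectedness makes it constant.
  have hidem : (fun t => F t * F t) = F := by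
    rw [← Continuous.ae_eq_iff_eq haarAddCircle (by fun_prop) (by fun_prop)]
    filter_upwards [hfF] with t ht
    rw [← ht]
    simp [hf]
  have hmaps : Set.MapsTo F Set.univ ({0, 1} : Set ℂ) := fun t _ => by
    have := congrFun hidem t
    rcases eq_or_ne (F t) 0 with h | h
    · exact Or.inl h
    · exact Or.inr (mul_left_cancel₀ h (by simpa using this))
  have hconst : ∀ s t : Torus, F s = F t := fun s t =>
    isPreconnected_univ.constant_of_mapsTo (Set.toFinite _).isDiscrete
      (map_continuous F).continuousOn hmaps (Set.mem_univ s) (Set.mem_univ t)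
  rcases hmaps (Set.mem_univ 0) with h | h
  · exfalso
    apply h0
    rw [measure_eq_zero_iff_ae_notMem]
    filter_upwards [hfF] with t ht htS
    rw [hconst t 0, h] at ht
    simp only [hf] at ht
    rw [if_pos htS] at ht
    exact one_ne_zero ht
  · filter_upwards [hfF] with t ht
    rw [hconst t 0, Set.mem_singleton_iff.1 h] at ht
    by_contra hne
    simp only [hf] at ht
    rw [if_neg hne] at ht
    exact zero_ne_one ht

/-! ### Large coefficients and correlations with translates -/

lemma hasSum_sq_norm_fourierCoeff {u : Torus → ℂ} (hu : Measurable u) (hu1 : ∀ t, ‖u t‖ = 1) :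
    HasSum (fun k => ‖fourierCoeff u k‖ ^ 2) 1 := by
  have hm := memLp_of_norm_le_one hu (fun t => (hu1 t).le) 2
  have h := hasSum_sq_fourierCoeff hm.toLp
  rw [fourierCoeff_congr_ae hm.coeFn_toLp] at h
  convert h
  rw [integral_congr_ae (g := fun _ => (1 : ℝ))]
  · simp
  · filter_upwards [hm.coeFn_toLp] with t ht
    rw [ht, hu1, one_pow]

/-- A unimodular function with bounded Wiener norm has a large Fourier coefficient. -/
lemma exists_le_norm_fourierCoeff {u : Torus → ℂ} (hu : Measurable u) (hu1 : ∀ t, ‖u t‖ = 1)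
    {C : ℝ≥0} (hC : wienerNorm u ≤ C) : ∃ m, 1 / ((C : ℝ) + 1) ≤ ‖fourierCoeff u m‖ := by
  by_contra! h
  have hs := summable_norm_fourierCoeff (ne_top_of_le_ne_top ENNReal.coe_ne_top hC)
  have hle : ∑' k, ‖fourierCoeff u k‖ ≤ C := by
    have := ENNReal.toReal_mono ENNReal.coe_ne_top hC
    rw [wienerNorm, ENNReal.tsum_toReal_eq fun k => enorm_ne_top] at this
    simpa using this
  -- Parseval bounds 1 by the largest coefficient times the `ℓ¹` norm; the `+ 1` makes the resulting
  -- inequality `1 ≤ C / (C + 1)` absurd.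
  have h1 : (1 : ℝ) ≤ 1 / ((C : ℝ) + 1) * C := by
    calc (1 : ℝ) = ∑' k, ‖fourierCoeff u k‖ ^ 2 := (hasSum_sq_norm_fourierCoeff hu hu1).tsum_eq.symm
      _ ≤ ∑' k, 1 / ((C : ℝ) + 1) * ‖fourierCoeff u k‖ := by
          refine (hasSum_sq_norm_fourierCoeff hu hu1).summable.tsum_le_tsum (fun k => ?_)
            (hs.mul_left _)
          rw [sq]
          exact mul_le_mul_of_nonneg_right (h k).le (norm_nonneg _)
      _ ≤ 1 / ((C : ℝ) + 1) * C := by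
          rw [tsum_mul_left]
          gcongr
  have hpos : (0 : ℝ) < (C : ℝ) + 1 := by positivity
  rw [one_div, ← div_eq_inv_mul, le_div_iff₀ hpos] at h1
  linarith

/-- The `m`-th Fourier coefficient of the autocorrelation of `u` is `|û(m)|²`, by Fubini, and is
bounded by its `L¹` norm. -/
lemma sq_norm_fourierCoeff_le_integral {u : Torus → ℂ} (hu : Measurable u)
    (hu1 : ∀ t, ‖u t‖ = 1) (m : ℤ) :
    ‖fourierCoeff u m‖ ^ 2 ≤
      ∫ a, ‖∫ t, u (t + a) * conj (u t) ∂haarAddCircle‖ ∂haarAddCircle := by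
  have hint : Integrable (Function.uncurry fun (a t : Torus) =>
      (fourier (-m) a : ℂ) * (u (t + a) * conj (u t)))
      (haarAddCircle.prod haarAddCircle) := by
    refine Integrable.of_bound (Measurable.aestronglyMeasurable ?_) 1 (ae_of_all _ fun p => ?_)
    · have h1 : Measurable fun p : Torus × Torus => (fourier (-m) p.1 : ℂ) :=
        (map_continuous (fourier (-m))).measurable.comp measurable_fst
      have h2 : Measurable fun p : Torus × Torus => u (p.2 + p.1) :=
        hu.comp (measurable_snd.add measurable_fst)
      have h3 : Measurable fun p : Torus × Torus => conj (u p.2) :=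
        Complex.continuous_conj.measurable.comp (hu.comp measurable_snd)
      exact h1.mul (h2.mul h3)
    · rw [Function.uncurry, norm_mul, fourier_apply, Circle.norm_coe]
      simp [hu1]
  have hswap := integral_integral_swap hint
  have hR : ∀ t : Torus, ∫ a, (fourier (-m) a : ℂ) * (u (t + a) * conj (u t)) ∂haarAddCircle =
      fourierCoeff u m * (fourier m t * conj (u t)) := by
    intro t
    have h := fourierCoeff_comp_add_right u t m
    rw [← mul_assoc, mul_comm (fourierCoeff u m), ← h, fourierCoeff, ← integral_mul_const]
    refine integral_congr_ae (ae_of_all _ fun a => ?_)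
    simp only [smul_eq_mul, add_comm t a]
    ring
  have hconj : ∫ t, (fourier m t : ℂ) * conj (u t) ∂haarAddCircle = conj (fourierCoeff u m) := by
    rw [fourierCoeff, ← integral_conj]
    refine integral_congr_ae (ae_of_all _ fun t => ?_)
    simp only [smul_eq_mul, map_mul, ← fourier_neg, neg_neg]
  simp_rw [hR] at hswap
  rw [integral_const_mul, hconj] at hswap
  have : ‖fourierCoeff u m‖ ^ 2 = ‖fourierCoeff u m * conj (fourierCoeff u m)‖ := by
    rw [norm_mul, RCLike.norm_conj, sq]
  rw [this, ← hswap]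
  refine (norm_integral_le_integral_norm _).trans (le_of_eq ?_)
  refine integral_congr_ae (ae_of_all _ fun a => ?_)
  simp only
  rw [integral_const_mul, norm_mul, fourier_apply, Circle.norm_coe, one_mul]

lemma norm_integral_le_one {v : Torus → ℂ} (hv : ∀ t, ‖v t‖ ≤ 1) :
    ‖∫ t, v t ∂haarAddCircle‖ ≤ 1 := by
  simpa using norm_integral_le_of_norm_le_const (μ := haarAddCircle) (ae_of_all _ hv)

/-- Wiener's lemma: if no level set of a unimodular function has positive measure, then its
moments tend to `0` in quadratic mean. -/
lemma tendsto_cesaro_sq_norm_moment {v : Torus → ℂ} (hv : Measurable v) (hv1 : ∀ t, ‖v t‖ = 1)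
    (h0 : ∀ c, haarAddCircle {t | v t = c} = 0) :
    Tendsto (fun N : ℕ => ((N : ℝ) + 1)⁻¹ *
      ∑ n ∈ Finset.range (N + 1), ‖∫ t, v t ^ n ∂haarAddCircle‖ ^ 2) atTop (𝓝 0) := by
  have hvc : Measurable fun t => conj (v t) := Complex.continuous_conj.measurable.comp hv
  set q : Torus × Torus → ℂ := fun p => v p.1 * conj (v p.2) with hq
  have hqm : Measurable q := (hv.comp measurable_fst).mul (hvc.comp measurable_snd)
  have hq1 : ∀ p, ‖q p‖ = 1 := fun p => by simp [hq, hv1]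
  -- Squared moments become integrals of `q ^ n` over the product, whose Cesàro limit is the
  -- indicator of the diagonal set `{q = 1}`; the absence of atoms makes this set null.
  have hmom : ∀ n : ℕ, ((‖∫ t, v t ^ n ∂haarAddCircle‖ ^ 2 : ℝ) : ℂ) =
      ∫ p, q p ^ n ∂(haarAddCircle.prod haarAddCircle) := by
    intro n
    have := integral_prod_mul (μ := haarAddCircle (T := 2 * π)) (ν := haarAddCircle (T := 2 * π))
      (fun t => v t ^ n) (fun t => conj (v t ^ n))
    rw [integral_conj, Complex.mul_conj, Complex.normSq_eq_norm_sq] at this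
    rw [← this]
    simp [hq, mul_pow]
  have hnull : ∀ᵐ p ∂((haarAddCircle (T := 2 * π)).prod (haarAddCircle (T := 2 * π))),
      q p ≠ 1 := by
    have hmeas : MeasurableSet {p | q p ≠ 1} := (hqm (measurableSet_singleton 1)).compl
    rw [Measure.ae_prod_iff_ae_ae hmeas]
    refine ae_of_all _ fun s => ?_
    filter_upwards [measure_eq_zero_iff_ae_notMem.1 (h0 (v s))] with t ht h
    apply ht
    have hinv : v t * conj (v t) = 1 := by
      rw [Complex.mul_conj, Complex.normSq_eq_norm_sq, hv1]; simp
    have h' : v s * conj (v t) = 1 := h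
    change v t = v s
    linear_combination v s * hinv - v t * h'
  have hlim : Tendsto (fun N : ℕ => ∫ p, ((N : ℂ) + 1)⁻¹ * ∑ n ∈ Finset.range (N + 1), q p ^ n
      ∂(haarAddCircle.prod haarAddCircle)) atTop
      (𝓝 (∫ p : Torus × Torus, (0 : ℂ) ∂(haarAddCircle.prod haarAddCircle))) := by
    refine tendsto_integral_of_dominated_convergence (fun _ => 1) (fun N => ?_)
      (integrable_const _) (fun N => ae_of_all _ fun p => norm_cesaro_pow_le (hq1 p) N) ?_
    · exact Measurable.aestronglyMeasurable (by fun_prop)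
    · filter_upwards [hnull] with p hp
      simpa [hp] using tendsto_cesaro_pow (hq1 p)
  rw [integral_zero] at hlim
  have hre := (Complex.continuous_re.tendsto _).comp hlim
  refine hre.congr fun N => ?_
  have hint : ∀ n ∈ Finset.range (N + 1), Integrable (fun p => q p ^ n)
      ((haarAddCircle (T := 2 * π)).prod (haarAddCircle (T := 2 * π))) := fun n _ =>
    Integrable.of_bound (hqm.pow_const n).aestronglyMeasurable 1
      (ae_of_all _ fun p => by rw [norm_pow, hq1, one_pow])
  rw [Function.comp_apply, integral_const_mul, integral_finsetSum _ hint]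
  simp_rw [← hmom]
  rw [← Complex.ofReal_sum, show ((N : ℂ) + 1)⁻¹ = (((N : ℝ) + 1)⁻¹ : ℝ) by push_cast; rfl,
    ← Complex.ofReal_mul, Complex.ofReal_re]

/-- If the powers of a unimodular function `u` are bounded in the Wiener norm, then for some `a`
of infinite order the quotient `u (t + a) / u t` is constant on a set of positive measure. -/
lemma exists_translate_measure_ne_zero {u : Torus → ℂ} (hu : Measurable u)
    (hu1 : ∀ t, ‖u t‖ = 1) {C : ℝ≥0} (hC : ∀ n : ℕ, wienerNorm (fun t => u t ^ n) ≤ C) :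
    ∃ a : Torus, (∀ k : ℤ, k ≠ 0 → (fourier k a : ℂ) ≠ 1) ∧
      ∃ c : ℂ, haarAddCircle {t | u (t + a) * conj (u t) = c} ≠ 0 := by
  by_contra! hcon
  set ψ : ℕ → Torus → ℂ := fun n a => ∫ t, (u (t + a) * conj (u t)) ^ n ∂haarAddCircle with hψ
  have hjm : Measurable fun p : Torus × Torus => u (p.2 + p.1) * conj (u p.2) :=
    (hu.comp (measurable_snd.add measurable_fst)).mul
      (Complex.continuous_conj.measurable.comp (hu.comp measurable_snd))
  have hψm : ∀ n, Measurable (ψ n) := fun n =>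
    ((hjm.pow_const n).stronglyMeasurable.integral_prod_right').measurable
  have hψ1 : ∀ n a, ‖ψ n a‖ ≤ 1 := fun n a => norm_integral_le_one fun t => by simp [hu1]
  set δ : ℝ := (1 / ((C : ℝ) + 1)) ^ 2 with hδ
  have hδ0 : 0 < δ := by positivity
  have hsq : ∀ n, δ ^ 2 ≤ ∫ a, ‖ψ n a‖ ^ 2 ∂haarAddCircle := by
    intro n
    have hun : Measurable fun t => u t ^ n := hu.pow_const n
    have hun1 : ∀ t, ‖u t ^ n‖ = 1 := fun t => by rw [norm_pow, hu1, one_pow]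
    obtain ⟨m, hm⟩ := exists_le_norm_fourierCoeff hun hun1 (hC n)
    have h1 : δ ≤ ∫ a, ‖ψ n a‖ ∂haarAddCircle := by
      refine (pow_le_pow_left₀ (by positivity) hm 2).trans
        ((sq_norm_fourierCoeff_le_integral hun hun1 m).trans (le_of_eq ?_))
      simp only [hψ, mul_pow, map_pow]
    have hi1 : Integrable (fun a => ‖ψ n a‖) haarAddCircle :=
      (integrable_of_norm_le_one (hψm n) (hψ1 n)).norm
    have hi2 : Integrable (fun a => ‖ψ n a‖ ^ 2) haarAddCircle :=
      Integrable.of_bound ((hψm n).norm.pow_const 2).aestronglyMeasurable 1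
        (ae_of_all _ fun a => by
          rw [norm_pow, norm_norm]; exact pow_le_one₀ (norm_nonneg _) (hψ1 n a))
    -- Integrating `(‖ψ n a‖ - δ) ^ 2 ≥ 0` turns the `L¹` lower bound into an `L²` one.
    have h2 : ∫ a, (2 * δ * ‖ψ n a‖ - δ ^ 2) ∂haarAddCircle ≤
        ∫ a, ‖ψ n a‖ ^ 2 ∂haarAddCircle := by
      refine integral_mono ((hi1.const_mul _).sub (integrable_const _)) hi2 fun a => ?_
      simp only
      nlinarith [sq_nonneg (‖ψ n a‖ - δ)]
    rw [integral_sub (hi1.const_mul _) (integrable_const _), integral_const_mul,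
      integral_const, probReal_univ, one_smul] at h2
    nlinarith
  have hlim : Tendsto (fun N : ℕ => ∫ a, ((N : ℝ) + 1)⁻¹ *
      ∑ n ∈ Finset.range (N + 1), ‖ψ n a‖ ^ 2 ∂haarAddCircle) atTop
      (𝓝 (∫ _ : Torus, (0 : ℝ) ∂haarAddCircle)) := by
    refine tendsto_integral_of_dominated_convergence (fun _ => 1) (fun N => ?_)
      (integrable_const _) (fun N => ae_of_all _ fun a => ?_) ?_
    · exact (Measurable.const_mul (Finset.measurable_sum _ fun n _ =>
        (hψm n).norm.pow_const 2) _).aestronglyMeasurable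
    · rw [Real.norm_of_nonneg (by positivity), inv_mul_le_iff₀ (by positivity), mul_one]
      calc ∑ n ∈ Finset.range (N + 1), ‖ψ n a‖ ^ 2
          ≤ ∑ n ∈ Finset.range (N + 1), (1 : ℝ) := Finset.sum_le_sum fun n _ =>
            pow_le_one₀ (norm_nonneg _) (hψ1 n a)
        _ = (N : ℝ) + 1 := by simp
    · filter_upwards [ae_fourier_ne_one] with a ha
      exact tendsto_cesaro_sq_norm_moment (v := fun t => u (t + a) * conj (u t))
        (hjm.comp measurable_prodMk_left) (fun t => by simp [hu1]) (hcon a ha)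
  rw [integral_zero] at hlim
  have hge : δ ^ 2 ≤ 0 := by
    refine ge_of_tendsto' hlim fun N => ?_
    rw [integral_const_mul, integral_finsetSum]
    · rw [le_inv_mul_iff₀ (by positivity)]
      calc ((N : ℝ) + 1) * δ ^ 2 = ∑ n ∈ Finset.range (N + 1), δ ^ 2 := by simp
        _ ≤ _ := Finset.sum_le_sum fun n _ => hsq n
    · intro n _
      exact Integrable.of_bound ((hψm n).norm.pow_const 2).aestronglyMeasurable 1
        (ae_of_all _ fun a => by
          rw [norm_pow, norm_norm]; exact pow_le_one₀ (norm_nonneg _) (hψ1 n a))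
  exact absurd hge (pow_pos hδ0 2).not_ge

/-- The Beurling–Helson theorem for measurable functions: a unimodular function whose powers
are bounded in the Wiener norm is a multiple of a character. -/
theorem exists_ae_eq_const_mul_fourier {u : Torus → ℂ} (hu : Measurable u)
    (hu1 : ∀ t, ‖u t‖ = 1) {C : ℝ≥0} (hC : ∀ n : ℕ, wienerNorm (fun t => u t ^ n) ≤ C) :
    ∃ (k : ℤ) (γ : ℂ), ∀ᵐ t ∂haarAddCircle, u t = γ * fourier k t := by
  obtain ⟨a, ha, c, hc⟩ := exists_translate_measure_ne_zero hu hu1 hC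
  have hua : Measurable fun t => u (t + a) := hu.comp (measurable_add_const a)
  have huc : Measurable fun t => conj (u t) := Complex.continuous_conj.measurable.comp hu
  have hc1 : ‖c‖ = 1 := by
    obtain ⟨t, ht⟩ := nonempty_of_measure_ne_zero hc
    rw [← (show u (t + a) * conj (u t) = c from ht)]
    simp [hu1]
  have hcc : conj c * c = 1 := by
    rw [mul_comm, Complex.mul_conj, Complex.normSq_eq_norm_sq, hc1]; simp
  have hquot : ∀ᵐ t ∂haarAddCircle, u (t + a) = c * u t := by
    have h1 : ∀ᵐ t ∂haarAddCircle, conj c * (u (t + a) * conj (u t)) = 1 := by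
      refine ae_eq_one_of_measure_ne_zero (C := C * C) ((hua.mul huc).const_mul _)
        (fun t => by simp [hu1, hc1]) (ENNReal.mul_ne_top ENNReal.coe_ne_top ENNReal.coe_ne_top)
        (fun n => ?_) (fun h => hc (measure_mono_null (fun t ht => ?_) h))
      · have h2 : (fun t => (conj c * (u (t + a) * conj (u t))) ^ n) =
            fun t => conj c ^ n * (u (t + a) ^ n * conj (u t ^ n)) := by
          ext t; rw [mul_pow, mul_pow, map_pow]
        have h3 : ‖conj c ^ n‖ₑ = 1 := by
          rw [← ofReal_norm, norm_pow, RCLike.norm_conj, hc1, one_pow, ENNReal.ofReal_one]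
        have h4 := wienerNorm_comp_add_right (fun t => u t ^ n) a
        have huc' : Measurable fun t => conj (u t ^ n) :=
          Complex.continuous_conj.measurable.comp (hu.pow_const n)
        rw [h2, wienerNorm_const_mul, h3, one_mul]
        refine (wienerNorm_mul_le (hua.pow_const n) (fun t => by simp [hu1])
          huc' (fun t => by simp [hu1])
          ?_).trans ?_
        · rw [h4]; exact ne_top_of_le_ne_top ENNReal.coe_ne_top (hC n)
        · rw [h4, wienerNorm_conj]; exact mul_le_mul' (hC n) (hC n)
      · have ht' : u (t + a) * conj (u t) = c := ht
        change conj c * (u (t + a) * conj (u t)) = 1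
        rw [ht', hcc]
    filter_upwards [h1] with t ht
    have hut : u t * conj (u t) = 1 := by
      rw [Complex.mul_conj, Complex.normSq_eq_norm_sq, hu1]; simp
    linear_combination (c * u t) * ht - u (t + a) * u t * conj (u t) * hcc - u (t + a) * hut
  have hcoef : ∀ k, (fourier k a : ℂ) * fourierCoeff u k = c * fourierCoeff u k := by
    intro k
    rw [← fourierCoeff_comp_add_right, fourierCoeff_congr_ae hquot, fourierCoeff.const_mul]
  have hW : wienerNorm u ≤ C := by simpa using hC 1
  obtain ⟨k, hk⟩ := exists_le_norm_fourierCoeff hu hu1 hW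
  have hk0 : fourierCoeff u k ≠ 0 := by
    rw [← norm_pos_iff]; exact lt_of_lt_of_le (by positivity) hk
  have hck : (fourier k a : ℂ) = c := mul_right_cancel₀ hk0 (hcoef k)
  -- Two active frequencies `j`, `k` would both give `c` at `a`, so the character `j - k` would be 1
  -- at `a`, against its infinite order.
  have hzero : ∀ j, j ≠ k → fourierCoeff u j = 0 := by
    intro j hj
    by_contra h
    apply ha (j - k) (sub_ne_zero.2 hj)
    rw [sub_eq_add_neg, fourier_add, mul_right_cancel₀ h (hcoef j), fourier_neg, hck, mul_comm,
      hcc]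
  obtain ⟨F, huF, hF⟩ := exists_continuous_ae_eq hu (fun t => (hu1 t).le)
    (ne_top_of_le_ne_top ENNReal.coe_ne_top hW)
  refine ⟨k, fourierCoeff u k, ?_⟩
  filter_upwards [huF] with t ht
  rw [ht]
  refine (hF t).unique (hasSum_single k fun j hj => ?_)
  rw [hzero j hj, zero_mul]

/-! ### Real functions with bounded exponentials -/

lemma fourierCoeff_const_mul_fourier (γ : ℂ) (k j : ℤ) :
    fourierCoeff (fun t : Torus => γ * fourier k t) j = if j = k then γ else 0 := by
  rw [fourierCoeff.const_mul, fourierCoeff_fourier, Pi.single_apply]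
  simp

lemma norm_exp_I_mul_mul (l x : ℝ) : ‖Complex.exp (Complex.I * l * x)‖ = 1 := by
  rw [mul_assoc, mul_comm, ← Complex.ofReal_mul, Complex.norm_exp_ofReal_mul_I]

lemma ae_eq_const_of_wienerNorm_exp_le {g : Torus → ℝ} (hg : Measurable g) {C : ℝ≥0}
    (hC : ∀ l : ℝ, wienerNorm (fun t => Complex.exp (Complex.I * l * g t)) ≤ C) :
    ∃ c : ℝ, ∀ᵐ t ∂haarAddCircle, g t = c := by
  have hchar : ∀ l : ℝ, ∃ (k : ℤ) (γ : ℂ), ∀ᵐ t ∂haarAddCircle,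
      Complex.exp (Complex.I * l * g t) = γ * fourier k t := by
    intro l
    refine exists_ae_eq_const_mul_fourier (C := C) (by fun_prop)
      (fun t => norm_exp_I_mul_mul l (g t)) fun n => ?_
    convert hC (n * l) using 3 with t
    rw [← Complex.exp_nat_mul]
    push_cast
    ring_nf
  have hconst : ∀ l : ℝ, ∃ γ : ℂ, ∀ᵐ t ∂haarAddCircle,
      Complex.exp (Complex.I * l * g t) = γ := by
    intro l
    obtain ⟨k, γ, hk⟩ := hchar l
    -- The frequency for `l` is `M` times the one for `l / M`; as `M` exceeds `|k|`, divisibility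
    -- forces `k = 0`.
    set M : ℕ := k.natAbs + 1 with hM
    have hM0 : (M : ℂ) ≠ 0 := Nat.cast_ne_zero.2 (by omega)
    obtain ⟨k', γ', hk'⟩ := hchar (l / M)
    have hγ : γ ≠ 0 := by
      obtain ⟨t, ht⟩ := hk.exists
      rintro rfl
      rw [zero_mul] at ht
      exact Complex.exp_ne_zero _ ht
    have hpow : ∀ᵐ t : Torus ∂haarAddCircle,
        γ * fourier k t = γ' ^ M * fourier (M * k') t := by
      filter_upwards [hk, hk'] with t h1 h2
      have h3 : (fourier (M * k') t : ℂ) = fourier k' t ^ M := by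
        simp only [fourier_apply, mul_smul]
        rw [natCast_zsmul, toCircle_nsmul, Circle.coe_pow]
      rw [← h1, h3, ← mul_pow, ← h2, ← Complex.exp_nat_mul]
      congr 1
      push_cast
      field_simp
    have hcoef := congrFun (fourierCoeff_congr_ae hpow) k
    rw [fourierCoeff_const_mul_fourier, fourierCoeff_const_mul_fourier, if_pos rfl] at hcoef
    have hkM : k = M * k' := by
      by_contra h
      rw [if_neg h] at hcoef
      exact hγ hcoef
    have hk0 : k = 0 := by
      refine Int.eq_zero_of_abs_lt_dvd (m := M) ⟨k', hkM⟩ ?_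
      rw [hM]
      push_cast
      omega
    refine ⟨γ, ?_⟩
    filter_upwards [hk] with t ht
    rw [ht, hk0, fourier_zero, mul_one]
  choose γ hγ using fun j : ℕ => hconst (1 / ((j : ℝ) + 1))
  have hall := ae_all_iff.2 hγ
  obtain ⟨s, hs⟩ := hall.exists
  refine ⟨g s, ?_⟩
  filter_upwards [hall] with t ht
  -- Taking `l = 1 / (j + 1)` shows that `g t - g s` is a multiple of `2π(j + 1)`, which exceeds it
  -- in absolute value, so it vanishes.
  obtain ⟨j, hj⟩ := exists_nat_gt |g t - g s|
  have h := (ht j).trans (hs j).symm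
  rw [Complex.exp_eq_exp_iff_exists_int] at h
  obtain ⟨m, hm⟩ := h
  have hj0 : (0 : ℝ) < (j : ℝ) + 1 := by positivity
  have h2 : 1 / ((j : ℝ) + 1) * g t = 1 / ((j : ℝ) + 1) * g s + m * (2 * π) := by
    have h3 : Complex.I * ((1 / ((j : ℝ) + 1) * g t : ℝ) : ℂ) =
        Complex.I * ((1 / ((j : ℝ) + 1) * g s + m * (2 * π) : ℝ) : ℂ) := by
      push_cast at hm ⊢
      linear_combination hm
    exact_mod_cast mul_left_cancel₀ Complex.I_ne_zero h3
  have h4 : g t - g s = m * (2 * π * (j + 1)) := by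
    field_simp at h2
    linear_combination h2
  have hm0 : m = 0 := by
    by_contra hne
    have h5 : (1 : ℝ) ≤ |(m : ℝ)| := by exact_mod_cast Int.one_le_abs hne
    have h6 : |g t - g s| = |(m : ℝ)| * (2 * π * (j + 1)) := by
      rw [h4, abs_mul, abs_of_pos (a := 2 * π * ((j : ℝ) + 1)) (by positivity)]
    have h7 : (j : ℝ) + 1 ≤ 2 * π * (j + 1) := by nlinarith [Real.pi_gt_three]
    nlinarith
  rw [hm0, Int.cast_zero, zero_mul] at h4
  linarith

lemma AEMeasurable.ae_eq_const_of_iSup_wienerNorm_lt_top {g : Torus → ℝ} (hg : AEMeasurable g)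
    (hW : (⨆ l : ℝ, wienerNorm (fun t => Complex.exp (Complex.I * l * g t))) < ⊤) :
    ∃ c : ℝ, ∀ᵐ t, g t = c := by
  have hmk := ae_volume_iff_ae_haarAddCircle.1 hg.ae_eq_mk
  lift (⨆ l : ℝ, wienerNorm (fun t => Complex.exp (Complex.I * l * g t))) to ℝ≥0
    using hW.ne with C hC
  obtain ⟨c, hc⟩ := ae_eq_const_of_wienerNorm_exp_le hg.measurable_mk (C := C) fun l => by
    rw [hC]
    refine le_trans (le_of_eq (wienerNorm_congr_ae ?_))
      (le_iSup (fun l : ℝ => wienerNorm fun t => Complex.exp (Complex.I * l * g t)) l)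
    filter_upwards [hmk] with t ht
    rw [ht]
  refine ⟨c, ae_volume_iff_ae_haarAddCircle.2 ?_⟩
  filter_upwards [hmk, hc] with t h1 h2
  rw [h1, h2]

/-! ### Absolutely continuous circle mappings -/

/-- The winding integer depends continuously on `t`, hence is constant. -/
lemma IsCircleMapping.exists_degree {φ : ℝ → ℝ} (hφ : IsCircleMapping φ) :
    ∃ m : ℤ, ∀ t, φ (t + 2 * π) = φ t + 2 * π * m := by
  choose m hm using hφ.add_two_pi
  have hcast : (fun t => (m t : ℝ)) = fun t => (φ (t + 2 * π) - φ t) / (2 * π) := by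
    ext t
    rw [hm t]
    field_simp
    ring
  have hcont : Continuous m := by
    rw [Int.isClosedEmbedding_coe_real.isEmbedding.continuous_iff]
    change Continuous fun t => (m t : ℝ)
    rw [hcast]
    have := hφ.continuous
    fun_prop
  refine ⟨m 0, fun t => ?_⟩
  rw [hm t, PreconnectedSpace.constant inferInstance hcont (x := t) (y := 0)]

lemma IsCircleMapping.expPow_coe {φ : ℝ → ℝ} (hφ : IsCircleMapping φ) (n : ℤ) (x : ℝ) :
    hφ.expPow n (x : Torus) = Complex.exp (Complex.I * n * φ x) :=
  (hφ.periodic_exp n).lift_coe x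

lemma Function.Periodic.measurable_lift {E : Type*} [MeasurableSpace E] {f : ℝ → E}
    (hf : Function.Periodic f (2 * π)) (hm : Measurable f) :
    Measurable (hf.lift : Torus → E) :=
  QuotientAddGroup.measurable_from_quotient.2 hm

lemma IsCircleMapping.measurable_expPow {φ : ℝ → ℝ} (hφ : IsCircleMapping φ) (n : ℤ) :
    Measurable (hφ.expPow n) := by
  refine (hφ.periodic_exp n).measurable_lift ?_
  have := hφ.continuous
  exact Continuous.measurable (by fun_prop)

lemma IsCircleMapping.norm_expPow {φ : ℝ → ℝ} (hφ : IsCircleMapping φ) (n : ℤ) (t : Torus) :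
    ‖hφ.expPow n t‖ = 1 := by
  induction t using QuotientAddGroup.induction_on with
  | H x =>
    rw [hφ.expPow_coe]
    exact_mod_cast norm_exp_I_mul_mul (n : ℝ) (φ x)

/-- A property of almost every point of a fundamental interval, read on the circle. -/
lemma ae_exists_coe_of_ae {p : ℝ → Prop} (hp : ∀ᵐ x, x ∈ Set.Icc 0 (0 + 2 * π) → p x) :
    ∀ᵐ t : Torus ∂haarAddCircle, ∃ x : ℝ, (x : Torus) = t ∧ p x := by
  rw [← ae_volume_iff_ae_haarAddCircle]
  have h1 := (measurePreserving_subtype_coe (μa := (volume : Measure ℝ))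
    (measurableSet_Ioc (a := (0 : ℝ)) (b := 0 + 2 * π))).comp
    (measurePreserving_equivIoc (2 * π) (a := 0))
  have h2 : ∀ᵐ x ∂volume.restrict (Set.Ioc 0 (0 + 2 * π)), p x := by
    rw [ae_restrict_iff' measurableSet_Ioc]
    filter_upwards [hp] with x hx hI
    exact hx (Set.Ioc_subset_Icc_self hI)
  filter_upwards [h1.quasiMeasurePreserving.ae h2] with t ht
  exact ⟨equivIoc (2 * π) 0 t, (equivIoc (2 * π) 0).symm_apply_apply t, ht⟩

/-- Rescaled difference quotients of an absolutely continuous circle mapping, exponentiated,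
converge to the exponential of the derivative without increasing the Wiener norm too much. -/
lemma IsCircleMapping.wienerNorm_exp_deriv_le {φ : ℝ → ℝ} (hφ : IsCircleMapping φ)
    (hac : AbsolutelyContinuousOnInterval φ 0 (0 + 2 * π)) {n : ℕ → ℤ}
    (hn : ∀ N : ℤ, ∃ k : ℕ, N < |n k|) {C : ℝ≥0}
    (hC : ∀ k : ℕ, wienerNorm (hφ.expPow (n k)) ≤ C)
    (hper : Function.Periodic (deriv φ) (2 * π)) (s : ℝ) :
    wienerNorm (fun t => Complex.exp (Complex.I * s * (hper.lift t : ℝ))) ≤ (C * C : ℝ≥0) := by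
  choose κ hκ using fun N : ℕ => hn N
  set ν : ℕ → ℤ := fun N => n (κ N) with hν
  have hν0 : ∀ N, (ν N : ℝ) ≠ 0 := fun N => by
    have : 0 < |ν N| := lt_of_le_of_lt (Int.natCast_nonneg N) (hκ N)
    exact_mod_cast abs_pos.1 this
  have hinv : Tendsto (fun N => ((ν N : ℝ))⁻¹) atTop (𝓝[≠] 0) := by
    rw [tendsto_nhdsWithin_iff]
    refine ⟨?_, Eventually.of_forall fun N => inv_ne_zero (hν0 N)⟩
    rw [tendsto_zero_iff_norm_tendsto_zero]
    simp_rw [norm_inv, Real.norm_eq_abs]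
    refine tendsto_inv_atTop_zero.comp
      (tendsto_atTop_mono (fun N => ?_) tendsto_natCast_atTop_atTop)
    have := (hκ N).le
    exact_mod_cast this
  -- The shift `s / ν N` cancels the growth of the exponent: the phase is `s` times a difference
  -- quotient of `φ` with step `s / ν N` when `s ≠ 0`.
  set F : ℕ → Torus → ℂ := fun N t =>
    hφ.expPow (ν N) (t + ((s * (ν N : ℝ)⁻¹ : ℝ) : Torus)) * conj (hφ.expPow (ν N) t) with hF
  have hm : ∀ N, Measurable fun t => hφ.expPow (ν N) (t + ((s * (ν N : ℝ)⁻¹ : ℝ) : Torus)) :=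
    fun N => (hφ.measurable_expPow (ν N)).comp (measurable_add_const _)
  have hmc : ∀ N, Measurable fun t => conj (hφ.expPow (ν N) t) := fun N =>
    Complex.continuous_conj.measurable.comp (hφ.measurable_expPow (ν N))
  refine wienerNorm_le_of_tendsto (F := F) (fun N => (hm N).mul (hmc N))
    (fun N t => by simp [hF, hφ.norm_expPow]) ?_ fun N => ?_
  · have hdiff := hac.ae_differentiableAt
    rw [Set.uIcc_of_le (by positivity)] at hdiff
    filter_upwards [ae_exists_coe_of_ae hdiff] with t ht
    obtain ⟨x, rfl, hx⟩ := ht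
    have hd : HasDerivAt (fun h => φ (x + s * h)) (deriv φ x * s) 0 := by
      have h1 : HasDerivAt (fun h : ℝ => x + s * h) s 0 := by
        simpa using ((hasDerivAt_id (0 : ℝ)).const_mul s).const_add x
      have h2 : HasDerivAt φ (deriv φ x) (x + s * 0) := by simpa using hx.hasDerivAt
      exact h2.comp 0 h1
    have hslope := hd.tendsto_slope_zero.comp hinv
    have hexp : Continuous fun y : ℝ => Complex.exp (Complex.I * y) := by fun_prop
    have hlim := (hexp.tendsto _).comp hslope
    have hval : (hper.lift (x : Torus) : ℝ) = deriv φ x := hper.lift_coe x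
    rw [hval, show Complex.I * (s : ℂ) * ((deriv φ x : ℝ) : ℂ) =
      Complex.I * ((deriv φ x * s : ℝ) : ℂ) by push_cast; ring]
    refine hlim.congr fun N => ?_
    simp only [hF, Function.comp_apply]
    rw [← AddCircle.coe_add, hφ.expPow_coe, hφ.expPow_coe, ← Complex.exp_conj, ← Complex.exp_add]
    congr 1
    simp only [map_mul, Complex.conj_I, Complex.conj_ofReal, map_intCast, smul_eq_mul, inv_inv,
      zero_add, mul_zero, add_zero]
    push_cast
    ring
  · have hW : wienerNorm (hφ.expPow (ν N)) ≤ C := hC (κ N)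
    have htr := wienerNorm_comp_add_right (hφ.expPow (ν N)) ((s * (ν N : ℝ)⁻¹ : ℝ) : Torus)
    refine (wienerNorm_mul_le (hm N) (fun t => (hφ.norm_expPow _ _).le) (hmc N)
      (fun t => by simp [hφ.norm_expPow]) ?_).trans ?_
    · rw [htr]; exact ne_top_of_le_ne_top ENNReal.coe_ne_top hW
    · rw [htr, wienerNorm_conj, ENNReal.coe_mul]
      exact mul_le_mul' hW hW

lemma IsCircleMapping.eq_int_mul_add_of_wienerNorm_le {φ : ℝ → ℝ} (hφ : IsCircleMapping φ)
    (hac : AbsolutelyContinuousOnInterval φ 0 (0 + 2 * π)) {n : ℕ → ℤ}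
    (hn : ∀ N : ℤ, ∃ k : ℕ, N < |n k|) {C : ℝ≥0}
    (hC : ∀ k : ℕ, wienerNorm (hφ.expPow (n k)) ≤ C) :
    ∃ ν : ℤ, ∀ t : ℝ, φ t = ν * t + φ 0 := by
  obtain ⟨m, hm⟩ := hφ.exists_degree
  have hper : Function.Periodic (deriv φ) (2 * π) := fun x => by
    rw [← deriv_comp_add_const, show (fun x => φ (x + 2 * π)) = fun x => φ x + 2 * π * m from
      funext hm, deriv_add_const]
  obtain ⟨c, hc⟩ := ae_eq_const_of_wienerNorm_exp_le
    (hper.measurable_lift (measurable_deriv φ)) fun s =>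
      hφ.wienerNorm_exp_deriv_le hac hn hC hper s
  have hae : ∀ᵐ x ∂volume.restrict (Set.Ioc 0 (0 + 2 * π)), deriv φ x = c := by
    filter_upwards [(AddCircle.measurePreserving_mk (2 * π) 0).quasiMeasurePreserving.ae
      (ae_volume_iff_ae_haarAddCircle.2 hc)] with x hx
    exact hx
  have hlin : ∀ x ∈ Set.Icc 0 (2 * π), φ x = c * x + φ 0 := by
    intro x hx
    have hint := (hac.mono (c := 0) (d := x) (by
      rw [Set.uIcc_of_le hx.1, Set.uIcc_of_le (by positivity)]
      exact Set.Icc_subset_Icc le_rfl (by linarith [hx.2]))).integral_deriv_eq_sub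
    rw [intervalIntegral.integral_congr_ae (g := fun _ => c)] at hint
    · simp only [intervalIntegral.integral_const, smul_eq_mul, sub_zero] at hint
      linarith
    · rw [ae_restrict_iff' measurableSet_Ioc] at hae
      filter_upwards [hae] with y hy hyI
      rw [Set.uIoc_of_le hx.1] at hyI
      exact hy ⟨hyI.1, by linarith [hyI.2, hx.2]⟩
  -- The increment of `φ` over one period is both `2πc` and `2πm`, so the slope is the degree.
  have hcm : c = m := by
    have h1 := hlin (2 * π) ⟨by positivity, le_rfl⟩
    have h2 := hm 0
    rw [zero_add, h1] at h2
    have h3 : (2 * π) * c = (2 * π) * m := by linarith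
    exact mul_left_cancel₀ Real.two_pi_pos.ne' h3
  refine ⟨m, fun t => ?_⟩
  have hper' : Function.Periodic (fun x => φ x - m * x) (2 * π) := fun x => by
    simp only [hm]; ring
  obtain ⟨y, hy, hty⟩ := hper'.exists_mem_Ico₀ Real.two_pi_pos t
  have h1 := hlin y ⟨hy.1, hy.2.le⟩
  simp only [h1, hcm] at hty
  linarith

end

theorem mainTheorem4 :
    (∀ g : Torus → ℝ, AEMeasurable g MeasureTheory.volume →
      (⨆ l : ℝ, wienerNorm (fun t => Complex.exp (Complex.I * l * g t))) < ⊤ →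
      ∃ c : ℝ, ∀ᵐ t ∂(MeasureTheory.volume : MeasureTheory.Measure Torus), g t = c) ∧
    (∀ (φ : ℝ → ℝ) (hφ : IsCircleMapping φ),
      (∀ a : ℝ, AbsolutelyContinuousOnInterval φ a (a + 2 * π)) →
      ∀ n : ℕ → ℤ, (∀ N : ℤ, ∃ k : ℕ, N < |n k|) →
      (∃ C : ℝ≥0, ∀ k : ℕ, wienerNorm (hφ.expPow (n k)) ≤ C) →
      ∃ ν : ℤ, ∀ t : ℝ, φ t = ν * t + φ 0) :=
  ⟨fun _ hg hW => hg.ae_eq_const_of_iSup_wienerNorm_lt_top hW,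
    fun _ hφ hac _ hn ⟨_, hC⟩ => hφ.eq_int_mul_add_of_wienerNorm_le (hac 0) hn hC⟩
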